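/- Let $d,k,b\ge 1$ and $\Delta\ge 0$ be integers. Let $\mathbb{M}_{k,\Delta,b}$ be the family of all sets $\Omega\subseteq\{1,\dots,d\}$ that are the union of exactly $k$ blocks of $b$ consecutive indices such that at least $\Delta$ indices lie strictly between any two consecutive blocks, and let $\mathcal{M}_{k,\Delta,b}=\{x\in\mathbb{R}^d : \operatorname{supp}(x)\in\mathbb{M}_{k,\Delta,b}\}$. A matrix $A\in\mathbb{R}^{m\times d}$ has the model-RIP for $\mathcal{M}_{k,\Delta,b}$ with constant $\delta\in(0,1)$ if $(1-\delta)\|x\|_2^2\le\|Ax\|_2^2\le(1+\delta)\|x\|_2^2$ for all $x\in\mathcal{M}_{k,\Delta,b}$. Then: 1. If $kb+(k-1)\Delta\le d$, then $|\mathbb{M}_{k,\Delta,b}|=\binom{d-kb-(k-1)\Delta+k}{k}$; otherwise $\mathbb{M}_{k,\Delta,b}$ is empty. 2. Write $L=\log\max\{e,\ d/k-(b+\Delta)+(\Delta-1)/k\}$. For every $\delta\in(0,1)$ there is a constant $C$, depending only on $\delta$, such that for all $d,k,b,\Delta$ there is a matrix with at most $C\,(kb+kL)$ rows that has the model-RIP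 for $\mathcal{M}_{k,\Delta,b}$ with constant $\delta$. In particular, for every fixed block size $b$ there are such matrices with $O\big(k\log\max\{e,\ d/k-(b+\Delta)+(\Delta-1)/k\}\big)$ rows, where the constant in $O(\cdot)$ depends only on $\delta$ and $b$. 3. If moreover $(\Delta-1)/k\le c$, then for every fixed $b$ there are such matrices with $O\big(k\log\max\{e,\ d/k-(b+\Delta)\}\big)$ rows, where the constant depends only on $\delta$, $b$ and $c$. -/

import Mathlib

open scoped Matrix

/-- The support patterns in `ℝ^d` (coordinates `0, …, d - 1`) made of exactly `k` blocks of `b`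
consecutive coordinates, any two consecutive blocks having at least `Δ` coordinates strictly
between them. The block number `i` is `p i, …, p i + b - 1`. -/
def blockSupports (d k Δ b : ℕ) : Set (Set (Fin d)) :=
  {Ω | ∃ p : Fin k → ℕ,
    (∀ i, p i + b ≤ d) ∧
    (∀ i j, i < j → p i + b + Δ ≤ p j) ∧
    Ω = {x : Fin d | ∃ i, p i ≤ (x : ℕ) ∧ (x : ℕ) < p i + b}}

/-- The block-separated sparsity model: the vectors whose support is one of these patterns. -/
def blockModel (d k Δ b : ℕ) : Set (EuclideanSpace ℝ (Fin d)) :=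
  {x | {i : Fin d | x i ≠ 0} ∈ blockSupports d k Δ b}

/-- The restricted isometry property of `A` over the model `M`, with constant `δ`
(all norms are Euclidean). -/
def HasModelRIP {m d : ℕ} (A : Matrix (Fin m) (Fin d) ℝ) (M : Set (EuclideanSpace ℝ (Fin d)))
    (δ : ℝ) : Prop :=
  ∀ x ∈ M,
    (1 - δ) * ‖x‖ ^ 2 ≤ ‖(WithLp.toLp 2 (A *ᵥ x.ofLp) : EuclideanSpace ℝ (Fin m))‖ ^ 2 ∧
    ‖(WithLp.toLp 2 (A *ᵥ x.ofLp) : EuclideanSpace ℝ (Fin m))‖ ^ 2 ≤ (1 + δ) * ‖x‖ ^ 2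

/-! The model lies in a union of `N` coordinate subspaces of dimension at most `k * b`, where `N` is
the number of supports. For one unit vector, a Gaussian matrix with `m` rows, scaled by `1 / √m`,
distorts the squared norm by more than `η` with probability at most `2 * exp (-m * η ^ 2 / 8)`.
Every subspace has a `1/2`-net of at most `5 ^ (k * b)` points, and control on sums and differences
of net points extends to the whole subspace (`abs_norm_sq_sub_le_of_halfNet`). So some matrix works
as soon as `m` exceeds a multiple of `log N + k * b`, the multiple depending on `δ` only
(`exists_hasModelRIP_of_supports`).

Contracting blocks and obligatory gaps identifies the supports with the `k`-subsets of a shorter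
interval (`blockStarts_eq_range`). Thus `N` is a binomial coefficient, and
`choose_le_exp_mul_div_pow` bounds `log N` by a multiple of `k * L`. -/

open MeasureTheory ProbabilityTheory Module
open scoped RealInnerProductSpace

/-! ### Nets of the unit ball and extension of near-isometry from a net. -/

section Net

/-- The unit ball of a finite-dimensional normed space has a `1/2`-net of cardinality at most
`5 ^ finrank ℝ E`. -/
theorem exists_halfNet_unitBall (E : Type*) [NormedAddCommGroup E] [NormedSpace ℝ E]
    [FiniteDimensional ℝ E] :
    ∃ N : Finset E, N.card ≤ 5 ^ finrank ℝ E ∧ (∀ u ∈ N, ‖u‖ ≤ 1) ∧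
      ∀ x : E, ‖x‖ ≤ 1 → ∃ u ∈ N, ‖x - u‖ ≤ 1 / 2 := by
  classical
  -- Separated sets are taken at scale 2, where the bound `5 ^ finrank` is known; a largest one,
  -- halved, is the net.
  let P : ℕ → Prop := fun n ↦ ∃ s : Finset E, s.card = n ∧ (∀ c ∈ s, ‖c‖ ≤ 2) ∧
    ∀ c ∈ s, ∀ d ∈ s, c ≠ d → 1 ≤ ‖c - d‖
  have hP0 : P 0 := ⟨∅, by simp⟩
  have hPb : ∀ n, P n → n ≤ 5 ^ finrank ℝ E := by
    rintro n ⟨s, rfl, h1, h2⟩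
    exact Besicovitch.card_le_of_separated s h1 h2
  obtain ⟨s, hs, h1, h2⟩ : P (Nat.findGreatest P (5 ^ finrank ℝ E)) :=
    Nat.findGreatest_spec (Nat.zero_le _) hP0
  have hmax : ∀ n, P n → n ≤ s.card := fun n hn ↦ hs ▸ Nat.le_findGreatest (hPb n hn) hn
  refine ⟨s.image fun c ↦ (1 / 2 : ℝ) • c, Finset.card_image_le.trans (hPb _ ⟨s, rfl, h1, h2⟩),
    ?_, ?_⟩
  · simp only [Finset.mem_image]
    rintro u ⟨c, hc, rfl⟩
    have := h1 c hc
    rw [norm_smul]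
    norm_num
    linarith
  · intro x hx
    by_contra! hcon
    have hfar : ∀ c ∈ s, 1 ≤ ‖(2 : ℝ) • x - c‖ := by
      intro c hc
      have h := hcon _ (Finset.mem_image_of_mem _ hc)
      have he : (2 : ℝ) • x - c = (2 : ℝ) • (x - (1 / 2 : ℝ) • c) := by
        rw [smul_sub, smul_smul]; norm_num
      rw [he, norm_smul, Real.norm_two]
      linarith
    have hnot : (2 : ℝ) • x ∉ s := fun h ↦ by
      have := hfar _ h
      norm_num at this
    have := hmax (s.card + 1) ⟨insert ((2 : ℝ) • x) s, Finset.card_insert_of_notMem hnot, ?_, ?_⟩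
    · omega
    · intro c hc
      rcases Finset.mem_insert.1 hc with rfl | hc
      · rw [norm_smul, Real.norm_two]; linarith
      · exact h1 c hc
    · intro c hc d hd hcd
      rcases Finset.mem_insert.1 hc with rfl | hc <;> rcases Finset.mem_insert.1 hd with rfl | hd
      · exact absurd rfl hcd
      · exact hfar d hd
      · rw [norm_sub_rev]; exact hfar c hc
      · exact h2 c hc d hd hcd

/-- A bound for an operator on a `1/2`-net of the unit ball gives twice that bound for its norm. -/
theorem opNorm_le_two_mul_of_halfNet {E F : Type*} [NormedAddCommGroup E] [NormedSpace ℝ E]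
    [NormedAddCommGroup F] [NormedSpace ℝ F] {N : Set E}
    (hN : ∀ x : E, ‖x‖ ≤ 1 → ∃ u ∈ N, ‖x - u‖ ≤ 1 / 2) (f : E →L[ℝ] F) {η : ℝ}
    (hf : ∀ u ∈ N, ‖f u‖ ≤ η) : ‖f‖ ≤ 2 * η := by
  have h : ‖f‖ ≤ η + ‖f‖ * (1 / 2) := by
    have h0 : 0 ≤ η := by
      obtain ⟨u, hu, -⟩ := hN 0 (by simp)
      exact (norm_nonneg _).trans (hf u hu)
    refine f.opNorm_le_of_unit_norm (by positivity) fun x hx ↦ ?_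
    obtain ⟨u, hu, hxu⟩ := hN x hx.le
    calc ‖f x‖ = ‖f u + f (x - u)‖ := by simp
      _ ≤ ‖f u‖ + ‖f (x - u)‖ := norm_add_le _ _
      _ ≤ η + ‖f‖ * (1 / 2) := add_le_add (hf u hu) (f.le_opNorm_of_le hxu)
  linarith

/-- If a linear map almost preserves the norms of the sums and differences of the points of a
`1/2`-net of the unit ball, then it almost preserves all norms. -/
theorem abs_norm_sq_sub_le_of_halfNet {E F : Type*} [NormedAddCommGroup E]
    [InnerProductSpace ℝ E] [NormedAddCommGroup F] [InnerProductSpace ℝ F]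
    {N : Set E} (hN : ∀ x : E, ‖x‖ ≤ 1 → ∃ u ∈ N, ‖x - u‖ ≤ 1 / 2) (hN1 : ∀ u ∈ N, ‖u‖ ≤ 1)
    (T : E →L[ℝ] F) {η : ℝ} (hη : 0 ≤ η)
    (hadd : ∀ u ∈ N, ∀ v ∈ N, |‖T (u + v)‖ ^ 2 - ‖u + v‖ ^ 2| ≤ η * ‖u + v‖ ^ 2)
    (hsub : ∀ u ∈ N, ∀ v ∈ N, |‖T (u - v)‖ ^ 2 - ‖u - v‖ ^ 2| ≤ η * ‖u - v‖ ^ 2) (x : E) :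
    |‖T x‖ ^ 2 - ‖x‖ ^ 2| ≤ 4 * η * ‖x‖ ^ 2 := by
  -- The defect is quadratic, so its bilinear form is estimated: polarisation bounds it by `η` on
  -- pairs of net points, and passing from the net to the ball doubles the bound once per argument.
  let B : E →L[ℝ] E →L[ℝ] ℝ := (innerSL ℝ).bilinearComp T T - innerSL ℝ
  have hB : ∀ u v, B u v = ⟪T u, T v⟫ - ⟪u, v⟫ := fun u v ↦ rfl
  have hBN : ∀ u ∈ N, ∀ v ∈ N, ‖B u v‖ ≤ η := by
    intro u hu v hv
    have h1 := abs_le.1 (hadd u hu v hv)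
    have h2 := abs_le.1 (hsub u hu v hv)
    have hpar : η * ‖u + v‖ ^ 2 + η * ‖u - v‖ ^ 2 ≤ η * 4 := by
      rw [← mul_add]
      refine mul_le_mul_of_nonneg_left ?_ hη
      have := parallelogram_law_with_norm ℝ u v
      have hu1 := hN1 u hu
      have hv1 := hN1 v hv
      nlinarith [norm_nonneg u, norm_nonneg v]
    have hpol : 4 * B u v = (‖T (u + v)‖ ^ 2 - ‖u + v‖ ^ 2) - (‖T (u - v)‖ ^ 2 - ‖u - v‖ ^ 2) := by
      rw [hB, map_add, map_sub, norm_add_sq_real, norm_add_sq_real, norm_sub_sq_real,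
        norm_sub_sq_real]
      ring
    rw [Real.norm_eq_abs, abs_le]
    constructor <;> linarith [h1.1, h1.2, h2.1, h2.2]
  have hnorm : ‖B‖ ≤ 2 * (2 * η) :=
    opNorm_le_two_mul_of_halfNet hN B fun u hu ↦
      opNorm_le_two_mul_of_halfNet hN (B u) fun v hv ↦ hBN u hu v hv
  have hx : ‖T x‖ ^ 2 - ‖x‖ ^ 2 = B x x := by
    rw [hB, real_inner_self_eq_norm_sq, real_inner_self_eq_norm_sq]
  rw [hx, ← Real.norm_eq_abs]
  calc ‖B x x‖ ≤ ‖B‖ * ‖x‖ * ‖x‖ := B.le_opNorm₂ x x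
    _ ≤ 2 * (2 * η) * ‖x‖ * ‖x‖ := by gcongr
    _ = 4 * η * ‖x‖ ^ 2 := by ring

end Net

/-! ### Gaussian exponential moments and concentration. -/

theorem integral_exp_mul_sq_gaussianReal {t : ℝ} (ht : t < 1) :
    ∫ x, Real.exp (t / 2 * x ^ 2) ∂(gaussianReal 0 1) = (√(1 - t))⁻¹ := by
  rw [integral_gaussianReal_eq_integral_smul one_ne_zero]
  have h : ∀ x : ℝ, gaussianPDFReal 0 1 x • Real.exp (t / 2 * x ^ 2) =
      (√(2 * Real.pi))⁻¹ * Real.exp (-((1 - t) / 2) * x ^ 2) := by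
    intro x
    simp only [gaussianPDFReal, smul_eq_mul, NNReal.coe_one, mul_one, sub_zero]
    rw [mul_assoc, ← Real.exp_add]
    congr 2
    ring
  simp_rw [h]
  rw [integral_const_mul, integral_gaussian, ← Real.sqrt_inv, ← Real.sqrt_inv,
    ← Real.sqrt_mul (by positivity)]
  congr 1
  have : 1 - t ≠ 0 := by linarith
  have := Real.pi_ne_zero
  field_simp

/-- After squaring, the claim is `1 ≤ exp (t + t ^ 2) * (1 - t)`. For `t ≤ 0` the linear bound on
`exp` gives `1 - t ^ 3`; for `t ≥ 0` the quadratic one gives at least `1 + t ^ 2 / 2 - 3 * t ^ 3 /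
2`, whence the threshold `1 / 3`. -/
theorem inv_sqrt_one_sub_le_exp {t : ℝ} (h1 : t ≤ 1 / 3) :
    (√(1 - t))⁻¹ ≤ Real.exp ((t + t ^ 2) / 2) := by
  have hpos : 0 < 1 - t := by linarith
  have key : 1 ≤ Real.exp (t + t ^ 2) * (1 - t) := by
    rcases le_total 0 t with h | h
    · have := Real.quadratic_le_exp_of_nonneg (x := t + t ^ 2) (by positivity)
      have h2 : 1 + t + 3 / 2 * t ^ 2 ≤ Real.exp (t + t ^ 2) := by
        nlinarith [pow_nonneg h 3, pow_nonneg h 4]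
      nlinarith [mul_nonneg (sq_nonneg t) (by linarith : 0 ≤ 1 / 3 - t)]
    · have := Real.add_one_le_exp (t + t ^ 2)
      nlinarith [mul_nonneg (sq_nonneg t) (by linarith : 0 ≤ -t)]
  rw [Real.exp_half, ← Real.sqrt_inv]
  refine Real.sqrt_le_sqrt ?_
  rwa [inv_le_iff_one_le_mul₀ hpos]

section Gaussian

variable {E : Type*} [NormedAddCommGroup E] [InnerProductSpace ℝ E] [FiniteDimensional ℝ E]
  [MeasurableSpace E] [BorelSpace E]

theorem stdGaussian_map_inner {x : E} (hx : ‖x‖ = 1) :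
    (stdGaussian E).map (fun a ↦ ⟪x, a⟫) = gaussianReal 0 1 := by
  have h := IsGaussian.map_eq_gaussianReal (μ := stdGaussian E) (innerSL ℝ x)
  rw [integral_strongDual_stdGaussian, variance_dual_stdGaussian, innerSL_apply_norm, hx] at h
  simpa using h

theorem integral_exp_mul_inner_sq_stdGaussian {x : E} (hx : ‖x‖ = 1) {t : ℝ} (ht : t < 1) :
    ∫ a, Real.exp (t / 2 * ⟪x, a⟫ ^ 2) ∂(stdGaussian E) = (√(1 - t))⁻¹ := by
  rw [← integral_exp_mul_sq_gaussianReal ht, ← stdGaussian_map_inner hx, integral_map]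
  · fun_prop
  · fun_prop

theorem integral_exp_mul_sum_inner_sq_stdGaussian (m : ℕ) {x : E} (hx : ‖x‖ = 1) {t : ℝ}
    (ht : t < 1) :
    ∫ a, Real.exp (t / 2 * ∑ j, ⟪x, a j⟫ ^ 2) ∂(Measure.pi fun _ : Fin m ↦ stdGaussian E) =
      (√(1 - t))⁻¹ ^ m := by
  simp_rw [Finset.mul_sum, Real.exp_sum]
  rw [integral_fintype_prod_eq_pow (fun a : E ↦ Real.exp (t / 2 * ⟪x, a⟫ ^ 2)),
    integral_exp_mul_inner_sq_stdGaussian hx ht, Fintype.card_fin]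

/-- Both tails of the squared length of a Gaussian projection, as exponential moments. -/
theorem integrable_and_integral_exp_le (m : ℕ) {x : E} (hx : ‖x‖ = 1) {t : ℝ} (ht : t ≤ 1 / 3)
    (c : ℝ) :
    Integrable (fun a : Fin m → E ↦ Real.exp (t / 2 * (∑ j, ⟪x, a j⟫ ^ 2 - c * m)))
        (Measure.pi fun _ : Fin m ↦ stdGaussian E) ∧
      ∫ a, Real.exp (t / 2 * (∑ j, ⟪x, a j⟫ ^ 2 - c * m))
        ∂(Measure.pi fun _ : Fin m ↦ stdGaussian E) ≤
        Real.exp (m * ((t + t ^ 2) / 2 - t / 2 * c)) := by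
  have h0 := integral_exp_mul_sum_inner_sq_stdGaussian m hx (t := t) (by linarith)
  have hpos : 0 < √(1 - t) := Real.sqrt_pos.2 (by linarith)
  have hint : Integrable (fun a : Fin m → E ↦ Real.exp (t / 2 * ∑ j, ⟪x, a j⟫ ^ 2))
      (Measure.pi fun _ : Fin m ↦ stdGaussian E) := by
    -- A function with nonzero Bochner integral is integrable.
    refine not_imp_comm.1 integral_undef ?_
    rw [h0]
    positivity
  have he : ∀ a : Fin m → E, Real.exp (t / 2 * (∑ j, ⟪x, a j⟫ ^ 2 - c * m)) =
      Real.exp (t / 2 * ∑ j, ⟪x, a j⟫ ^ 2) * Real.exp (-(t / 2 * (c * m))) := fun a ↦ by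
    rw [← Real.exp_add]; congr 1; ring
  simp_rw [he]
  refine ⟨hint.mul_const _, ?_⟩
  rw [integral_mul_const, h0]
  calc (√(1 - t))⁻¹ ^ m * Real.exp (-(t / 2 * (c * m)))
      ≤ Real.exp ((t + t ^ 2) / 2) ^ m * Real.exp (-(t / 2 * (c * m))) := by
        gcongr
        exact inv_sqrt_one_sub_le_exp ht
    _ = _ := by
        rw [← Real.exp_nat_mul, ← Real.exp_add]
        congr 1
        ring

/-- The Johnson-Lindenstrauss lemma for a finite set of unit vectors. -/
theorem exists_abs_sum_inner_sq_sub_le (T : Finset E) (hT : ∀ x ∈ T, ‖x‖ = 1) {η : ℝ}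
    (h0 : 0 < η) (h1 : η ≤ 1 / 2) {m : ℕ}
    (hm : (T.card : ℝ) * (2 * Real.exp (-(m * η ^ 2 / 8))) < 1) :
    ∃ a : Fin m → E, ∀ x ∈ T, |∑ j, ⟪x, a j⟫ ^ 2 - m| ≤ η * m := by
  -- The union bound in expectation form: if the `f x` sum to less than 1 at `a`, both exponents are
  -- negative for every `x`, which is the two-sided estimate. The choice `t = ± η / 2` minimises the
  -- moment bound.
  let f : E → (Fin m → E) → ℝ := fun x a ↦
    Real.exp (η / 2 / 2 * (∑ j, ⟪x, a j⟫ ^ 2 - (1 + η) * m)) +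
      Real.exp (-(η / 2) / 2 * (∑ j, ⟪x, a j⟫ ^ 2 - (1 - η) * m))
  have hup := fun x hx ↦ integrable_and_integral_exp_le m (hT x hx) (t := η / 2) (by linarith)
    (1 + η)
  have hlo := fun x hx ↦ integrable_and_integral_exp_le m (hT x hx) (t := -(η / 2)) (by linarith)
    (1 - η)
  have hint : ∀ x ∈ T, Integrable (f x) (Measure.pi fun _ : Fin m ↦ stdGaussian E) :=
    fun x hx ↦ (hup x hx).1.add (hlo x hx).1
  have hle : ∀ x ∈ T, ∫ a, f x a ∂(Measure.pi fun _ : Fin m ↦ stdGaussian E) ≤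
      2 * Real.exp (-(m * η ^ 2 / 8)) := by
    intro x hx
    rw [integral_add (hup x hx).1 (hlo x hx).1, two_mul]
    refine add_le_add ((hup x hx).2.trans_eq ?_) ((hlo x hx).2.trans_eq ?_) <;>
    · congr 1
      ring
  obtain ⟨a, ha⟩ := exists_le_integral (integrable_finsetSum T hint)
  rw [integral_finsetSum T hint] at ha
  have hlt : ∑ x ∈ T, f x a < 1 :=
    (ha.trans ((Finset.sum_le_sum hle).trans_eq (by simp))).trans_lt hm
  refine ⟨a, fun x hx ↦ ?_⟩
  have hx1 : f x a < 1 :=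
    (Finset.single_le_sum (f := fun x ↦ f x a) (fun y _ ↦ by positivity) hx).trans_lt hlt
  have hA := Real.exp_pos (η / 2 / 2 * (∑ j, ⟪x, a j⟫ ^ 2 - (1 + η) * m))
  have hB := Real.exp_pos (-(η / 2) / 2 * (∑ j, ⟪x, a j⟫ ^ 2 - (1 - η) * m))
  have hA1 := Real.exp_lt_one_iff.1 (lt_of_le_of_lt (le_add_of_nonneg_right hB.le) hx1)
  have hB1 := Real.exp_lt_one_iff.1 (lt_of_le_of_lt (le_add_of_nonneg_left hA.le) hx1)
  rw [abs_le]
  constructor <;> nlinarith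

end Gaussian

/-! ### Near-isometries on finitely many subspaces. -/

theorem norm_sq_toLp_mulVec_of_rows {m d : ℕ} (a : Fin m → EuclideanSpace ℝ (Fin d)) (r : ℝ)
    (x : EuclideanSpace ℝ (Fin d)) :
    ‖(WithLp.toLp 2 (Matrix.of (fun j i ↦ r * a j i) *ᵥ x.ofLp) : EuclideanSpace ℝ (Fin m))‖ ^ 2 =
      r ^ 2 * ∑ j, ⟪x, a j⟫ ^ 2 := by
  rw [EuclideanSpace.real_norm_sq_eq, Finset.mul_sum]
  refine Finset.sum_congr rfl fun j _ ↦ ?_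
  simp only [Matrix.mulVec, dotProduct, Matrix.of_apply, PiLp.inner_apply, RCLike.inner_apply,
    conj_trivial, mul_assoc]
  rw [← Finset.mul_sum, mul_pow]

/-- A finite family of subspaces of dimension at most `s` has a matrix that almost preserves all
norms on each of them, with a number of rows logarithmic in the cardinality of nets. -/
theorem exists_matrix_abs_norm_sq_sub_le {d s m : ℕ}
    (𝒱 : Finset (Submodule ℝ (EuclideanSpace ℝ (Fin d)))) (hs : ∀ V ∈ 𝒱, finrank ℝ V ≤ s) {δ : ℝ}
    (h0 : 0 < δ) (h1 : δ < 1)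
    (hm : (𝒱.card : ℝ) * 25 ^ s * 4 * Real.exp (-(m * δ ^ 2 / 128)) < 1) :
    ∃ A : Matrix (Fin m) (Fin d) ℝ, ∀ V ∈ 𝒱, ∀ x ∈ V,
      |‖(WithLp.toLp 2 (A *ᵥ x.ofLp) : EuclideanSpace ℝ (Fin m))‖ ^ 2 - ‖x‖ ^ 2| ≤
        δ * ‖x‖ ^ 2 := by
  classical
  rcases 𝒱.eq_empty_or_nonempty with rfl | hne
  · exact ⟨0, by simp⟩
  have hm0 : 0 < m := by
    rcases Nat.eq_zero_or_pos m with rfl | h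
    · have h2 : (1 : ℝ) ≤ 𝒱.card := by exact_mod_cast hne.card_pos
      have h3 : (1 : ℝ) ≤ 25 ^ s := one_le_pow₀ (by norm_num)
      norm_num at hm
      nlinarith
    · exact h
  have hm1 : (0 : ℝ) < m := by exact_mod_cast hm0
  choose N hNcard hN1 hN using
    fun V : Submodule ℝ (EuclideanSpace ℝ (Fin d)) ↦ exists_halfNet_unitBall V
  let D : Submodule ℝ (EuclideanSpace ℝ (Fin d)) → Finset (EuclideanSpace ℝ (Fin d)) := fun V ↦
    (N V ×ˢ N V).image (fun p ↦ ((p.1 + p.2 : V) : EuclideanSpace ℝ (Fin d))) ∪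
      (N V ×ˢ N V).image (fun p ↦ ((p.1 - p.2 : V) : EuclideanSpace ℝ (Fin d)))
  have hD : ∀ V ∈ 𝒱, (D V).card ≤ 2 * 25 ^ s := by
    intro V hV
    have hprod : (N V ×ˢ N V).card ≤ 25 ^ s := by
      rw [Finset.card_product]
      calc (N V).card * (N V).card ≤ 5 ^ s * 5 ^ s := by
            have := (hNcard V).trans (Nat.pow_le_pow_right (by norm_num) (hs V hV))
            gcongr
        _ = 25 ^ s := by rw [← mul_pow]; norm_num
    calc (D V).card ≤ _ := Finset.card_union_le _ _
      _ ≤ (N V ×ˢ N V).card + (N V ×ˢ N V).card :=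
        add_le_add Finset.card_image_le Finset.card_image_le
      _ ≤ 2 * 25 ^ s := by omega
  let T : Finset (EuclideanSpace ℝ (Fin d)) :=
    ((𝒱.biUnion D).filter (· ≠ 0)).image fun x ↦ (‖x‖⁻¹ : ℝ) • x
  have hT1 : ∀ x ∈ T, ‖x‖ = 1 := by
    intro x hx
    obtain ⟨y, hy, rfl⟩ := Finset.mem_image.1 hx
    exact norm_smul_inv_norm (𝕜 := ℝ) (Finset.mem_filter.1 hy).2
  have hTcard : T.card ≤ 𝒱.card * (2 * 25 ^ s) :=
    Finset.card_image_le.trans ((Finset.card_filter_le _ _).trans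
      (Finset.card_biUnion_le_card_mul _ _ _ hD))
  have hTcard' : (T.card : ℝ) ≤ 𝒱.card * (2 * 25 ^ s) := by exact_mod_cast hTcard
  -- Distortion `δ / 4` compensates the factor 4 lost in leaving the net, and makes the exponent `m
  -- * δ ^ 2 / 128`.
  obtain ⟨a, ha⟩ := exists_abs_sum_inner_sq_sub_le T hT1 (η := δ / 4) (m := m) (by positivity)
    (by linarith) (by
      refine lt_of_le_of_lt ?_ hm
      rw [show (m : ℝ) * (δ / 4) ^ 2 / 8 = m * δ ^ 2 / 128 by ring]
      calc (T.card : ℝ) * (2 * Real.exp (-(m * δ ^ 2 / 128)))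
          ≤ (𝒱.card * (2 * 25 ^ s)) * (2 * Real.exp (-(m * δ ^ 2 / 128))) := by gcongr
        _ = _ := by ring)
  set A : Matrix (Fin m) (Fin d) ℝ := Matrix.of fun j i ↦ (√m)⁻¹ * a j i with hA
  have hAx : ∀ x : EuclideanSpace ℝ (Fin d),
      ‖(WithLp.toLp 2 (A *ᵥ x.ofLp) : EuclideanSpace ℝ (Fin m))‖ ^ 2 =
        (m : ℝ)⁻¹ * ∑ j, ⟪x, a j⟫ ^ 2 := fun x ↦ by
    rw [hA, norm_sq_toLp_mulVec_of_rows, inv_pow, Real.sq_sqrt hm1.le]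
  have hDx : ∀ V ∈ 𝒱, ∀ x ∈ D V,
      |‖(WithLp.toLp 2 (A *ᵥ x.ofLp) : EuclideanSpace ℝ (Fin m))‖ ^ 2 - ‖x‖ ^ 2| ≤
        δ / 4 * ‖x‖ ^ 2 := by
    intro V hV x hx
    rw [hAx]
    rcases eq_or_ne x 0 with rfl | hx0
    · simp
    have hxn : 0 < ‖x‖ := norm_pos_iff.2 hx0
    have h := ha (‖x‖⁻¹ • x) (Finset.mem_image_of_mem _
      (Finset.mem_filter.2 ⟨Finset.mem_biUnion.2 ⟨V, hV, hx⟩, hx0⟩))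
    simp_rw [real_inner_smul_left, mul_pow] at h
    rw [← Finset.mul_sum] at h
    have e : (m : ℝ)⁻¹ * ∑ j, ⟪x, a j⟫ ^ 2 - ‖x‖ ^ 2 =
        (‖x‖ ^ 2 / m) * (‖x‖⁻¹ ^ 2 * ∑ j, ⟪x, a j⟫ ^ 2 - m) := by
      field_simp
    rw [e, abs_mul, abs_of_nonneg (by positivity : 0 ≤ ‖x‖ ^ 2 / (m : ℝ))]
    calc _ ≤ ‖x‖ ^ 2 / m * (δ / 4 * m) := by gcongr
      _ = _ := by field_simp
  refine ⟨A, fun V hV x hx ↦ ?_⟩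
  let S : V →L[ℝ] EuclideanSpace ℝ (Fin m) :=
    (LinearMap.toContinuousLinearMap (Matrix.toEuclideanLin A)).comp V.subtypeL
  have hS : ∀ y : V, S y = WithLp.toLp 2 (A *ᵥ (y : EuclideanSpace ℝ (Fin d)).ofLp) :=
    fun y ↦ rfl
  have := abs_norm_sq_sub_le_of_halfNet (N := (N V : Set V)) (hN V) (hN1 V) S (η := δ / 4)
    (by positivity)
    (fun u hu v hv ↦ by
      rw [hS]
      exact hDx V hV _ (Finset.mem_union_left _
        (Finset.mem_image_of_mem (fun p : V × V ↦ ((p.1 + p.2 : V) : EuclideanSpace ℝ (Fin d)))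
          (Finset.mk_mem_product hu hv))))
    (fun u hu v hv ↦ by
      rw [hS]
      exact hDx V hV _ (Finset.mem_union_right _
        (Finset.mem_image_of_mem (fun p : V × V ↦ ((p.1 - p.2 : V) : EuclideanSpace ℝ (Fin d)))
          (Finset.mk_mem_product hu hv)))) ⟨x, hx⟩
  rw [hS] at this
  calc _ ≤ 4 * (δ / 4) * ‖x‖ ^ 2 := this
    _ = _ := by ring

/-- The vectors supported in a set of at most `s` coordinates form a union of subspaces: there is
a matrix with the restricted isometry property over finitely many support patterns. -/
theorem exists_hasModelRIP_of_supports {d s m : ℕ} {𝒮 : Set (Set (Fin d))}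
    (hs : ∀ Ω ∈ 𝒮, Ω.ncard ≤ s) {δ : ℝ} (h0 : 0 < δ) (h1 : δ < 1)
    (hm : (𝒮.ncard : ℝ) * 25 ^ s * 4 * Real.exp (-(m * δ ^ 2 / 128)) < 1) :
    ∃ A : Matrix (Fin m) (Fin d) ℝ, HasModelRIP A {x | {i : Fin d | x i ≠ 0} ∈ 𝒮} δ := by
  classical
  let W : Set (Fin d) → Submodule ℝ (EuclideanSpace ℝ (Fin d)) := fun Ω ↦
    Submodule.span ℝ (Ω.toFinset.image fun i ↦ EuclideanSpace.single i (1 : ℝ))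
  have hW : ∀ Ω ∈ 𝒮, finrank ℝ (W Ω) ≤ s := fun Ω hΩ ↦
    (finrank_span_finset_le_card _).trans (Finset.card_image_le.trans
      ((Set.ncard_eq_toFinset_card' Ω).symm.le.trans (hs Ω hΩ)))
  have hfin : 𝒮.Finite := Set.toFinite _
  obtain ⟨A, hA⟩ := exists_matrix_abs_norm_sq_sub_le (m := m) (s := s) (hfin.toFinset.image W)
    (by
      intro V hV
      obtain ⟨Ω, hΩ, rfl⟩ := Finset.mem_image.1 hV
      exact hW Ω (hfin.mem_toFinset.1 hΩ)) h0 h1 (by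
      refine lt_of_le_of_lt ?_ hm
      have : ((hfin.toFinset.image W).card : ℝ) ≤ 𝒮.ncard := by
        rw [Set.ncard_eq_toFinset_card 𝒮 hfin]
        exact_mod_cast Finset.card_image_le
      gcongr)
  refine ⟨A, fun x hx ↦ ?_⟩
  have hxW : x ∈ W {i : Fin d | x i ≠ 0} := by
    have hsum : x = ∑ i, x i • EuclideanSpace.single i (1 : ℝ) := by
      ext j
      simp [Finset.sum_apply, Pi.single_apply]
    rw [hsum]
    refine Submodule.sum_mem _ fun i _ ↦ ?_
    by_cases hi : x i = 0
    · simp [hi]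
    · refine Submodule.smul_mem _ _ (Submodule.subset_span ?_)
      rw [← hsum]
      exact Finset.mem_coe.2 (Finset.mem_image_of_mem _ (by simpa using hi))
  have h := abs_le.1 (hA _ (Finset.mem_image_of_mem W (hfin.mem_toFinset.2 hx)) x hxW)
  constructor <;> linarith [h.1, h.2]

/-! ### Counting the supports. -/

/-- The union of the blocks of length `b` that start at the points of `p`. -/
def blockUnion (d k b : ℕ) (p : Fin k → ℕ) : Set (Fin d) :=
  {x : Fin d | ∃ i, p i ≤ (x : ℕ) ∧ (x : ℕ) < p i + b}

/-- The starting points of separated blocks. -/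
def blockStarts (d k Δ b : ℕ) : Set (Fin k → ℕ) :=
  {p | (∀ i, p i + b ≤ d) ∧ ∀ i j, i < j → p i + b + Δ ≤ p j}

theorem blockSupports_eq_image (d k Δ b : ℕ) :
    blockSupports d k Δ b = blockUnion d k b '' blockStarts d k Δ b := by
  ext Ω
  constructor
  · rintro ⟨p, h1, h2, rfl⟩
    exact ⟨p, ⟨h1, h2⟩, rfl⟩
  · rintro ⟨p, ⟨h1, h2⟩, rfl⟩
    exact ⟨p, h1, h2, rfl⟩

/-- The point `p i` lies in some block `j` of `q`. If `j < i`, that block is also a block of `p` and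
ends before `p i`; so `j ≥ i` and `q i ≤ q j ≤ p i`. -/
theorem blockStart_le_of_blockUnion_eq {d k Δ b : ℕ} (hb : 1 ≤ b) {p q : Fin k → ℕ}
    (hp : p ∈ blockStarts d k Δ b) (hq : q ∈ blockStarts d k Δ b)
    (h : blockUnion d k b p = blockUnion d k b q) (i : Fin k) (hi : ∀ j < i, p j = q j) :
    q i ≤ p i := by
  have hd : p i < d := by have := hp.1 i; omega
  have hmem : (⟨p i, hd⟩ : Fin d) ∈ blockUnion d k b q := by
    rw [← h]
    exact ⟨i, le_rfl, by simp; omega⟩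
  obtain ⟨j, hj1, hj2⟩ := hmem
  simp only at hj1 hj2
  rcases lt_trichotomy j i with hji | rfl | hij
  · have := hi j hji
    have := hp.2 j i hji
    omega
  · exact hj1
  · have := hq.2 i j hij
    omega

theorem injOn_blockUnion {d k Δ b : ℕ} (hb : 1 ≤ b) :
    Set.InjOn (blockUnion d k b) (blockStarts d k Δ b) := by
  intro p hp q hq h
  funext i
  induction i using WellFoundedLT.induction with
  | ind i ih =>
    exact le_antisymm (blockStart_le_of_blockUnion_eq hb hq hp h.symm i fun j hj ↦ (ih j hj).symm)
      (blockStart_le_of_blockUnion_eq hb hp hq h i ih)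

theorem blockStart_gap {d k Δ b : ℕ} {p : Fin k → ℕ} (hp : p ∈ blockStarts d k Δ b) {i j : Fin k}
    (hij : i ≤ j) : p i + ((j : ℕ) - i) * (b + Δ) ≤ p j := by
  obtain ⟨n, hn⟩ : ∃ n, (j : ℕ) = i + n := ⟨j - i, by omega⟩
  induction n generalizing j with
  | zero =>
    have : i = j := Fin.ext (by omega)
    simp [this]
  | succ n ih =>
    have hlt : (i : ℕ) + n < k := by omega
    have h1 := ih (j := ⟨i + n, hlt⟩) (Fin.le_def.2 (by simp)) rfl
    have h2 := hp.2 ⟨i + n, hlt⟩ j (Fin.lt_def.2 (by simp; omega))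
    simp only [Nat.add_sub_cancel_left] at h1
    rw [hn, Nat.add_sub_cancel_left, add_mul, one_mul]
    omega

/-- Contracting every block and every obligatory gap to a point turns the starting points of
separated blocks into the increasing sequences. -/
theorem blockStarts_eq_range {d k Δ b : ℕ} (hb : 1 ≤ b) :
    blockStarts d k Δ b = Set.range
      fun (f : Fin k ↪o Fin (d + k - (k * b + (k - 1) * Δ))) (i : Fin k) ↦
        (f i : ℕ) + i * (b + Δ - 1) := by
  obtain ⟨g, hg⟩ : ∃ g, b + Δ = g + 1 := ⟨b + Δ - 1, by omega⟩
  -- The case `k = 0` is separate because `k - 1` truncates.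
  have hS : k * b + (k - 1) * Δ + Δ = k * (g + 1) ∨ k = 0 := by
    rcases k with _ | k
    · exact Or.inr rfl
    · left
      rw [← hg, Nat.add_sub_cancel]
      ring
  have hg' : b + Δ - 1 = g := by omega
  rw [hg']
  ext p
  constructor
  · intro hp
    -- Consecutive starts differ by at least `g + 1`, so removing `g` per step keeps the sequence
    -- strictly increasing. The gaps to the first and to the last block give the two bounds.
    have hbound : ∀ i : Fin k, p i - i * g < d + k - (k * b + (k - 1) * Δ) ∧ i * g ≤ p i := by
      intro i
      have hk : k - 1 < k := by have := i.2; omega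
      have h1 := blockStart_gap hp (i := i) (j := ⟨k - 1, hk⟩) (Fin.le_def.2 (by simp; omega))
      have h0 := blockStart_gap hp (i := ⟨0, by omega⟩) (j := i) (Fin.le_def.2 (by simp))
      have h2 := hp.1 ⟨k - 1, hk⟩
      obtain ⟨n, hn⟩ : ∃ n, k = i + n + 1 := ⟨k - 1 - i, by omega⟩
      have hS' := hS.resolve_right (by omega)
      rw [hg] at h0 h1
      have e1 : k - 1 - (i : ℕ) = n := by omega
      simp only [e1, Nat.sub_zero] at h0 h1
      have e2 : k * (g + 1) = i * g + i + n * (g + 1) + (g + 1) :=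
        (congrArg (· * (g + 1)) hn).trans (by ring)
      have e3 : (i : ℕ) * (g + 1) = i * g + i := by ring
      constructor <;> omega
    have hstep : ∀ i j : Fin k, i < j → p i - i * g < p j - j * g := by
      intro i j hij
      have h1 := blockStart_gap hp hij.le
      obtain ⟨n, hn⟩ : ∃ n, (j : ℕ) = i + n + 1 := ⟨j - i - 1, by have := Fin.lt_def.1 hij; omega⟩
      have e1 : (j : ℕ) - i = n + 1 := by omega
      have hi := (hbound i).2
      have hj := (hbound j).2
      rw [e1, hg] at h1
      have e2 : (j : ℕ) * g = i * g + n * g + g := by rw [hn]; ring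
      have e3 : (n + 1) * (g + 1) = n * g + g + n + 1 := by ring
      omega
    refine ⟨OrderEmbedding.ofStrictMono (fun i ↦ ⟨p i - i * g, (hbound i).1⟩) fun i j hij ↦
      Fin.lt_def.2 (hstep i j hij), ?_⟩
    funext i
    exact Nat.sub_add_cancel (hbound i).2
  · rintro ⟨f, rfl⟩
    have hstep : ∀ (n : ℕ) (i j : Fin k), (j : ℕ) = i + n → (f i : ℕ) + n ≤ f j := by
      intro n
      induction n with
      | zero =>
        intro i j h
        rw [Fin.ext h]
        simp
      | succ n ih =>
        intro i j h
        have h1 := ih i ⟨i + n, by omega⟩ rfl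
        have h2 : (f ⟨i + n, by omega⟩ : ℕ) < f j :=
          Fin.lt_def.1 (f.lt_iff_lt.2 (Fin.lt_def.2 (by simp; omega)))
        omega
    constructor
    · intro i
      obtain ⟨n, hn⟩ : ∃ n, k = i + n + 1 := ⟨k - 1 - i, by omega⟩
      have h1 := hstep n i ⟨i + n, by omega⟩ rfl
      have h2 := (f ⟨i + n, by omega⟩).2
      have hS' := hS.resolve_right (by omega)
      have e2 : k * g = i * g + n * g + g := (congrArg (· * g) hn).trans (by ring)
      rw [mul_add, mul_one] at hS'
      simp only
      omega
    · intro i j hij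
      obtain ⟨n, hn⟩ : ∃ n, (j : ℕ) = i + n + 1 := ⟨j - i - 1, by have := Fin.lt_def.1 hij; omega⟩
      have h1 := hstep (n + 1) i j (by omega)
      have e2 : (j : ℕ) * g = i * g + n * g + g := by rw [hn]; ring
      simp only
      omega

theorem card_orderEmbedding_fin (k M : ℕ) : Nat.card (Fin k ↪o Fin M) = M.choose k := by
  rw [Nat.card_congr Set.powersetCard.ofFinEmbEquiv, Set.powersetCard.card, Nat.card_fin]

/-- If `d < k * b + (k - 1) * Δ`, the upper index is less than `k`, even when truncated, so the
value is 0 and the finite family is empty. -/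
theorem ncard_blockSupports {d k Δ b : ℕ} (hb : 1 ≤ b) :
    (blockSupports d k Δ b).ncard = (d + k - (k * b + (k - 1) * Δ)).choose k := by
  rw [blockSupports_eq_image, (injOn_blockUnion hb).ncard_image,
    blockStarts_eq_range hb, Set.ncard_range_of_injective, card_orderEmbedding_fin]
  intro f g h
  ext i
  simpa using congrFun h i

theorem ncard_le_of_mem_blockSupports {d k Δ b : ℕ} {Ω : Set (Fin d)}
    (h : Ω ∈ blockSupports d k Δ b) : Ω.ncard ≤ k * b := by
  obtain ⟨p, -, -, rfl⟩ := h
  rw [← Set.ncard_image_of_injective _ Fin.val_injective]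
  calc _ ≤ ((Finset.univ.biUnion fun i ↦ Finset.Ico (p i) (p i + b) : Finset ℕ) : Set ℕ).ncard := by
        refine Set.ncard_le_ncard ?_ (Finset.finite_toSet _)
        rintro _ ⟨x, ⟨i, hi⟩, rfl⟩
        simp only [Finset.coe_biUnion, Set.mem_iUnion]
        exact ⟨i, by simp, by simpa using hi⟩
    _ ≤ k * b := by
        rw [Set.ncard_coe_finset]
        refine (Finset.card_biUnion_le_card_mul _ _ b fun i _ ↦ by simp).trans_eq (by simp)

/-! ### Logarithmic estimates and the number of rows. -/

/-- Since `k ^ k / k!` is a term of the series of `exp k`, `1 / k!` is at most `(e / k) ^ k`. -/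
theorem choose_le_exp_mul_div_pow (n : ℕ) {k : ℕ} (hk : 1 ≤ k) :
    (n.choose k : ℝ) ≤ (Real.exp 1 * (n / k)) ^ k := by
  have hk0 : (0 : ℝ) < k := by exact_mod_cast hk
  have hf : (0 : ℝ) < k.factorial := by exact_mod_cast k.factorial_pos
  have h1 : (k : ℝ) ^ k ≤ Real.exp 1 ^ k * k.factorial := by
    have := Real.pow_div_factorial_le_exp (k : ℝ) hk0.le k
    rwa [div_le_iff₀ hf, ← Real.exp_one_pow] at this
  calc (n.choose k : ℝ) ≤ n ^ k / k.factorial := Nat.choose_le_pow_div k n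
    _ ≤ (Real.exp 1 * (n / k)) ^ k := by
      rw [mul_pow, div_pow, ← mul_div_assoc, div_le_div_iff₀ hf (by positivity)]
      calc (n : ℝ) ^ k * k ^ k ≤ n ^ k * (Real.exp 1 ^ k * k.factorial) := by gcongr
        _ = _ := by ring

/-- The logarithm of the number of supports. -/
theorem log_ncard_blockSupports_le {d k Δ b : ℕ} (hk : 1 ≤ k) (hb : 1 ≤ b)
    (hne : 0 < (blockSupports d k Δ b).ncard) :
    Real.log (blockSupports d k Δ b).ncard ≤ 3 * (k * Real.log (max (Real.exp 1)
      ((d : ℝ) / k - ((b : ℝ) + Δ) + ((Δ : ℝ) - 1) / k))) := by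
  set X := max (Real.exp 1) ((d : ℝ) / k - ((b : ℝ) + Δ) + ((Δ : ℝ) - 1) / k) with hX
  have hk0 : (0 : ℝ) < k := by exact_mod_cast hk
  have hk1 : (1 : ℝ) ≤ k := by exact_mod_cast hk
  have hXe : Real.exp 1 ≤ X := le_max_left _ _
  have he2 : (2 : ℝ) ≤ Real.exp 1 := by have := Real.add_one_le_exp (1 : ℝ); linarith
  have hX0 : 0 < X := (Real.exp_pos 1).trans_le hXe
  have hL : 1 ≤ Real.log X := (Real.le_log_iff_exp_le hX0).2 hXe
  rw [ncard_blockSupports hb] at hne ⊢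
  set M := d + k - (k * b + (k - 1) * Δ) with hM
  -- A nonzero count rules out truncation in `M`.
  have hkM : k ≤ M := by
    by_contra! h
    rw [Nat.choose_eq_zero_of_lt h] at hne
    exact lt_irrefl _ hne
  have hMr : (M : ℝ) = d + k - (k * b + (k - 1) * Δ) := by
    rw [hM, Nat.cast_sub (by omega)]
    push_cast [hk]
    ring
  -- The left side is at most `X + 2`, and `X + 2 ≤ 2 * X` because `X ≥ e ≥ 2`.
  have hMX : (M : ℝ) / k ≤ X * Real.exp 1 := by
    have h1 : (M : ℝ) / k = (d : ℝ) / k - ((b : ℝ) + Δ) + ((Δ : ℝ) - 1) / k + 1 + 1 / k := by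
      rw [hMr]
      field_simp
      ring
    have h2 : (d : ℝ) / k - ((b : ℝ) + Δ) + ((Δ : ℝ) - 1) / k ≤ X := le_max_right _ _
    have h3 : 1 / (k : ℝ) ≤ 1 := by rw [div_le_one hk0]; exact hk1
    nlinarith
  have hM0 : (0 : ℝ) < M := by exact_mod_cast (by omega : 0 < M)
  calc Real.log (M.choose k) ≤ Real.log ((Real.exp 1 * (M / k)) ^ k) :=
        Real.log_le_log (by exact_mod_cast hne) (choose_le_exp_mul_div_pow M hk)
    _ ≤ Real.log ((Real.exp 1 * (X * Real.exp 1)) ^ k) := by gcongr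
    _ = k * (2 + Real.log X) := by
        rw [Real.log_pow, Real.log_mul (Real.exp_ne_zero 1) (by positivity),
          Real.log_mul hX0.ne' (Real.exp_ne_zero 1), Real.log_exp]
        ring
    _ ≤ 3 * (k * Real.log X) := by nlinarith

/-- Matrices with the restricted isometry property, uniformly in all parameters of the model. -/
theorem exists_hasModelRIP_blockModel {δ : ℝ} (h0 : 0 < δ) (h1 : δ < 1) {d k Δ b : ℕ}
    (hk : 1 ≤ k) (hb : 1 ≤ b) :
    ∃ (m : ℕ) (A : Matrix (Fin m) (Fin d) ℝ),
      HasModelRIP A (blockModel d k Δ b) δ ∧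
      (m : ℝ) ≤ (768 / δ ^ 2 + 2) * ((k : ℝ) * b + (k : ℝ) * Real.log (max (Real.exp 1)
        ((d : ℝ) / k - ((b : ℝ) + Δ) + ((Δ : ℝ) - 1) / k))) := by
  have hkb : (1 : ℝ) ≤ (k : ℝ) * b := by exact_mod_cast Nat.mul_pos hk hb
  have hL : 0 ≤ (k : ℝ) * Real.log (max (Real.exp 1)
      ((d : ℝ) / k - ((b : ℝ) + Δ) + ((Δ : ℝ) - 1) / k)) :=
    mul_nonneg k.cast_nonneg (Real.log_nonneg
      (le_max_of_le_left (Real.one_le_exp zero_le_one)))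
  rcases Nat.eq_zero_or_pos (blockSupports d k Δ b).ncard with hN | hN
  · obtain ⟨A, hA⟩ := exists_hasModelRIP_of_supports (m := 0)
      (fun Ω hΩ ↦ ncard_le_of_mem_blockSupports hΩ) h0 h1 (by rw [hN]; simp)
    exact ⟨0, A, hA, by push_cast; positivity⟩
  have hlog := log_ncard_blockSupports_le hk hb hN
  generalize (k : ℝ) * Real.log (max (Real.exp 1)
      ((d : ℝ) / k - ((b : ℝ) + Δ) + ((Δ : ℝ) - 1) / k)) = L at hL hlog ⊢
  set n : ℝ := ((blockSupports d k Δ b).ncard : ℝ) with hn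
  have hn0 : 0 < n := by rw [hn]; exact_mod_cast hN
  set B := Real.log (n * 25 ^ (k * b) * 4) with hB
  have h25 : Real.log 25 ≤ 4 := by
    rw [Real.log_le_iff_le_exp (by norm_num),
      show Real.exp 4 = Real.exp 1 ^ 4 by rw [Real.exp_one_pow]; norm_num]
    calc (25 : ℝ) ≤ 2.7 ^ 4 := by norm_num
      _ ≤ Real.exp 1 ^ 4 := by gcongr; linarith [Real.exp_one_gt_d9]
  have h4 : Real.log 4 ≤ 2 := by
    rw [Real.log_le_iff_le_exp (by norm_num),
      show Real.exp 2 = Real.exp 1 ^ 2 by rw [Real.exp_one_pow]; norm_num]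
    calc (4 : ℝ) ≤ 2.7 ^ 2 := by norm_num
      _ ≤ Real.exp 1 ^ 2 := by gcongr; linarith [Real.exp_one_gt_d9]
  -- The bound is `3 * L + 4 * k * b + 2`, and the 2 is absorbed by `k * b ≥ 1`. Then `768 = 128 *
  -- 6`, while the `+ 2` in the final constant pays for rounding `m` up.
  have hBle : B ≤ 6 * (k * b + L) := by
    rw [hB, Real.log_mul (by positivity) (by norm_num), Real.log_mul hn0.ne' (by positivity),
      Real.log_pow]
    push_cast
    nlinarith
  set m := ⌈128 / δ ^ 2 * (6 * (k * b + L))⌉₊ + 1 with hm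
  have hlt : 128 / δ ^ 2 * (6 * (k * b + L)) < m := by
    rw [hm]; push_cast; exact (Nat.le_ceil _).trans_lt (lt_add_one _)
  have hBm : B < m * δ ^ 2 / 128 := by
    rw [div_mul_eq_mul_div, div_lt_iff₀ (by positivity)] at hlt
    linarith
  obtain ⟨A, hA⟩ := exists_hasModelRIP_of_supports (m := m)
    (fun Ω hΩ ↦ ncard_le_of_mem_blockSupports hΩ) h0 h1
    (𝒮 := blockSupports d k Δ b) (by
      rw [← hn, ← Real.exp_log (by positivity : 0 < n * 25 ^ (k * b) * 4), ← hB, ← Real.exp_add,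
        Real.exp_lt_one_iff]
      linarith)
  refine ⟨m, A, hA, ?_⟩
  have hceil := Nat.ceil_lt_add_one (a := 128 / δ ^ 2 * (6 * (k * b + L))) (by positivity)
  have hmr : (m : ℝ) ≤ 128 / δ ^ 2 * (6 * (k * b + L)) + 2 := by
    rw [hm]; push_cast; linarith
  calc (m : ℝ) ≤ _ := hmr
    _ ≤ 128 / δ ^ 2 * (6 * (k * b + L)) + 2 * (k * b + L) := by gcongr; linarith
    _ = _ := by ring

/-- An additive `c` costs at most a factor `1 + |c|` inside the logarithm, as the maximum is at
least 1; the extra summand is absorbed because the remaining logarithm is at least 1. -/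
theorem log_max_exp_one_add_le {x y c : ℝ} (hy : y ≤ c) :
    Real.log (max (Real.exp 1) (x + y)) ≤
      (1 + Real.log (1 + |c|)) * Real.log (max (Real.exp 1) x) := by
  have hX0 : 0 < max (Real.exp 1) x := lt_max_of_lt_left (Real.exp_pos 1)
  have hX1 : 1 ≤ max (Real.exp 1) x := le_max_of_le_left (Real.one_le_exp zero_le_one)
  have hL : 1 ≤ Real.log (max (Real.exp 1) x) :=
    (Real.le_log_iff_exp_le hX0).2 (le_max_left _ _)
  have hc : 0 ≤ Real.log (1 + |c|) := Real.log_nonneg (by linarith [abs_nonneg c])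
  have hle : max (Real.exp 1) (x + y) ≤ (1 + |c|) * max (Real.exp 1) x := by
    have h1 := mul_le_mul_of_nonneg_left hX1 (abs_nonneg c)
    refine max_le ?_ ?_
    · nlinarith [le_max_left (Real.exp 1) x, abs_nonneg c]
    · nlinarith [le_max_right (Real.exp 1) x, le_abs_self c]
  calc Real.log (max (Real.exp 1) (x + y)) ≤ Real.log ((1 + |c|) * max (Real.exp 1) x) :=
        Real.log_le_log (lt_max_of_lt_left (Real.exp_pos 1)) hle
    _ = Real.log (1 + |c|) + Real.log (max (Real.exp 1) x) :=
        Real.log_mul (by positivity) hX0.ne'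
    _ ≤ _ := by nlinarith

/-- The cutoff at `e` makes the logarithm at least 1, so `k * b` is at most `b` times the
logarithmic term. -/
theorem exists_hasModelRIP_blockModel_fixed {δ : ℝ} (h0 : 0 < δ) (h1 : δ < 1) {d k Δ b : ℕ}
    (hk : 1 ≤ k) (hb : 1 ≤ b) :
    ∃ (m : ℕ) (A : Matrix (Fin m) (Fin d) ℝ),
      HasModelRIP A (blockModel d k Δ b) δ ∧
      (m : ℝ) ≤ (768 / δ ^ 2 + 2) * (b + 1) * ((k : ℝ) * Real.log (max (Real.exp 1)
        ((d : ℝ) / k - ((b : ℝ) + Δ) + ((Δ : ℝ) - 1) / k))) := by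
  obtain ⟨m, A, hA, hm⟩ := exists_hasModelRIP_blockModel h0 h1 (d := d) (Δ := Δ) hk hb
  refine ⟨m, A, hA, hm.trans ?_⟩
  rw [mul_assoc]
  refine mul_le_mul_of_nonneg_left ?_ (by positivity)
  have hL : 1 ≤ Real.log (max (Real.exp 1)
      ((d : ℝ) / k - ((b : ℝ) + Δ) + ((Δ : ℝ) - 1) / k)) :=
    (Real.le_log_iff_exp_le (lt_max_of_lt_left (Real.exp_pos 1))).2 (le_max_left _ _)
  have := mul_le_mul_of_nonneg_left hL (by positivity : 0 ≤ (k : ℝ) * b)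
  linarith

theorem mainTheorem10 :
    -- the number of supports (no support, and the value `0`, if `d < k b + (k - 1) Δ`)
    (∀ d k Δ b : ℕ, 1 ≤ k → 1 ≤ b →
      (blockSupports d k Δ b).ncard = (d + k - (k * b + (k - 1) * Δ)).choose k) ∧
    -- the number of rows, uniformly in all parameters of the model
    (∀ δ : ℝ, 0 < δ → δ < 1 → ∃ C : ℝ, 0 < C ∧
      ∀ d k Δ b : ℕ, 1 ≤ k → 1 ≤ b →
        ∃ (m : ℕ) (A : Matrix (Fin m) (Fin d) ℝ),
          HasModelRIP A (blockModel d k Δ b) δ ∧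
          (m : ℝ) ≤ C * ((k : ℝ) * b + (k : ℝ) * Real.log (max (Real.exp 1)
            ((d : ℝ) / k - ((b : ℝ) + Δ) + ((Δ : ℝ) - 1) / k)))) ∧
    -- the number of rows for a fixed block size
    (∀ δ : ℝ, 0 < δ → δ < 1 → ∀ b : ℕ, 1 ≤ b → ∃ C : ℝ, 0 < C ∧
      ∀ d k Δ : ℕ, 1 ≤ k →
        ∃ (m : ℕ) (A : Matrix (Fin m) (Fin d) ℝ),
          HasModelRIP A (blockModel d k Δ b) δ ∧
          (m : ℝ) ≤ C * ((k : ℝ) * Real.log (max (Real.exp 1)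
            ((d : ℝ) / k - ((b : ℝ) + Δ) + ((Δ : ℝ) - 1) / k)))) ∧
    -- the case `(Δ - 1) / k = O(1)`
    (∀ δ : ℝ, 0 < δ → δ < 1 → ∀ b : ℕ, 1 ≤ b → ∀ c : ℝ, ∃ C : ℝ, 0 < C ∧
      ∀ d k Δ : ℕ, 1 ≤ k → ((Δ : ℝ) - 1) / k ≤ c →
        ∃ (m : ℕ) (A : Matrix (Fin m) (Fin d) ℝ),
          HasModelRIP A (blockModel d k Δ b) δ ∧
          (m : ℝ) ≤ C * ((k : ℝ) * Real.log (max (Real.exp 1)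
            ((d : ℝ) / k - ((b : ℝ) + Δ))))) := by
  refine ⟨fun d k Δ b _ hb ↦ ncard_blockSupports hb, fun δ h0 h1 ↦ ?_, fun δ h0 h1 b hb ↦ ?_,
    fun δ h0 h1 b hb c ↦ ?_⟩
  · exact ⟨768 / δ ^ 2 + 2, by positivity,
      fun d k Δ b hk hb ↦ exists_hasModelRIP_blockModel h0 h1 hk hb⟩
  · exact ⟨(768 / δ ^ 2 + 2) * (b + 1), by positivity,
      fun d k Δ hk ↦ exists_hasModelRIP_blockModel_fixed h0 h1 hk hb⟩
  · have hc : 0 ≤ Real.log (1 + |c|) := Real.log_nonneg (by linarith [abs_nonneg c])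
    refine ⟨(768 / δ ^ 2 + 2) * (b + 1) * (1 + Real.log (1 + |c|)), by positivity,
      fun d k Δ hk hΔ ↦ ?_⟩
    obtain ⟨m, A, hA, hm⟩ := exists_hasModelRIP_blockModel_fixed h0 h1 (d := d) (Δ := Δ) hk hb
    refine ⟨m, A, hA, hm.trans ?_⟩
    rw [mul_assoc (_ * _) (1 + _), mul_left_comm (1 + _)]
    refine mul_le_mul_of_nonneg_left ?_ (by positivity)
    exact mul_le_mul_of_nonneg_left (log_max_exp_one_add_le hΔ) k.cast_nonneg
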